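/- Let $n\ge 3$. A dissection of a convex $n$-gon is a set of pairwise non-crossing diagonals; the triangulations are the maximal dissections. A polytope $P$ is a realization of the associahedron $\mathcal A_n$ if $\dim P=n-3$ and there is an inclusion-reversing bijection from the dissections of the $n$-gon to the nonempty faces of $P$ (including $P$ itself) under which the triangulations correspond to the vertices, two vertices being joined by an edge exactly when the two triangulations differ by a single diagonal flip. $P$ is simple if each of its vertices lies on exactly $\dim P$ edges. Let $V=\{x\in\mathbb R^{n-2}: x_1+\cdots+x_{n-2}=0\}$ with the standard inner product. The normal fan of a polytope $P\subset V$ is the set $\Delta$ of the cones $\sigma_F=\{v\in V:\langle u,v\rangle\le\langle u',v\rangle \text{ for all } u\in F,\ u'\in P\}$, where $F$ runs over the nonempty faces of $P$. The star of a cone $\sigma\in\Delta$ is the set of all $\tau\in\Delta$ such that $\sigma$ and $\tau$ lie in a common cone of $\Delta$; its support is the union of its cones. $\Delta$ is locally convex if the support of the star of every ray ($1$-dimensional cone) of $\Delta$ is convex. Proposition. There is a simple polytope $P\subset V$ that is a realization of the associahedron $\mathcal A_n$ and whose normal fan $\Delta_n$ is locally convex. Moreover, $P$ can be chosen so that the following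 holds as well. The rays of $\Delta_n$ are exactly the rays $$\rho_{ij}=\mathbb R_{\ge0}\cdot\sum_{k=i}^{j}\Bigl(e_k-\tfrac1{n-2}(1,\dots,1)\Bigr),\qquad 1\le i\le j\le n-2,\ (i,j)\ne(1,n-2),$$ and the support of the star of $\rho_{ij}$ is the union of all closed type-$A_{n-3}$ Weyl chambers $\{x\in V: x_{\pi(1)}\ge x_{\pi(2)}\ge\cdots\ge x_{\pi(n-2)}\}$ ($\pi$ a permutation of $\{1,\dots,n-2\}$) on which $$x_i,x_{i+1},\dots,x_j\ \ge\ x_{i-1},\,x_{j+1}$$ holds, where the inequalities involving $x_{i-1}$ are omitted if $i=1$, and those involving $x_{j+1}$ if $j=n-2$. -/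

import Mathlib

namespace Associahedra

section Polytopes

variable {E : Type*} [NormedAddCommGroup E] [InnerProductSpace ℝ E]

/-- A polytope: the convex hull of a finite set of points. -/
def IsPolytope (P : Set E) : Prop :=
  ∃ s : Set E, s.Finite ∧ P = convexHull ℝ s

/-- The dimension of (the affine span of) a set. -/
noncomputable def dim (P : Set E) : ℕ :=
  Module.finrank ℝ (vectorSpan ℝ P)

/-- The nonempty faces of `P`, with `P` itself included: the sets of all points of `P`
at which some linear functional attains its extreme value over `P`. -/
def IsFace (P F : Set E) : Prop :=
  F.Nonempty ∧ IsExposed ℝ P F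

def IsVertex (P : Set E) (u : E) : Prop :=
  IsFace P {u}

def IsEdge (P F : Set E) : Prop :=
  IsFace P F ∧ dim F = 1

/-- A polytope of dimension `d` is simple if every vertex lies on exactly `d` edges. -/
def IsSimple (P : Set E) : Prop :=
  ∀ u, IsVertex P u → {F : Set E | IsEdge P F ∧ u ∈ F}.encard = dim P

/-- The cone `σ_F` of the (inner) normal fan; the dual space is identified with `E` by means of
the inner product. -/
def normalCone (P F : Set E) : Set E :=
  {v | ∀ u ∈ F, ∀ u' ∈ P, inner ℝ u v ≤ inner ℝ u' v}

def normalFan (P : Set E) : Set (Set E) :=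
  {σ | ∃ F, IsFace P F ∧ σ = normalCone P F}

/-- The star of a cone `σ` in a collection `Δ` of cones: all cones `τ` of `Δ` such that `σ` and `τ`
lie in some common cone of `Δ`. -/
def star (Δ : Set (Set E)) (σ : Set E) : Set (Set E) :=
  {τ | τ ∈ Δ ∧ ∃ κ ∈ Δ, σ ⊆ κ ∧ τ ⊆ κ}

/-- The union of all cones of a collection, as a point set. -/
def support (Δ : Set (Set E)) : Set E :=
  ⋃₀ Δ

/-- The rays of `Δ` are its one-dimensional cones. -/
def IsRay (Δ : Set (Set E)) (ρ : Set E) : Prop :=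
  ρ ∈ Δ ∧ Module.finrank ℝ (Submodule.span ℝ ρ) = 1

def IsLocallyConvex (Δ : Set (Set E)) : Prop :=
  ∀ ρ, IsRay Δ ρ → Convex ℝ (support (star Δ ρ))

end Polytopes

section Polygon

/-- The diagonals of a convex `n`-gon whose vertices are labelled `0, …, n - 1` in cyclic order:
pairs `a < b` of vertices that are not neighbours. -/
def IsDiagonal (n : ℕ) (d : Fin n × Fin n) : Prop :=
  (d.1 : ℕ) + 1 < d.2 ∧ ¬ ((d.1 : ℕ) = 0 ∧ (d.2 : ℕ) + 1 = n)

/-- Two diagonals cross (meet in their interiors) iff their end points interlace. -/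
def Cross {n : ℕ} (d e : Fin n × Fin n) : Prop :=
  (d.1 < e.1 ∧ e.1 < d.2 ∧ d.2 < e.2) ∨ (e.1 < d.1 ∧ d.1 < e.2 ∧ e.2 < d.2)

/-- Dissections of the `n`-gon: sets of pairwise non-crossing diagonals. -/
def IsDissection (n : ℕ) (D : Finset (Fin n × Fin n)) : Prop :=
  (∀ d ∈ D, IsDiagonal n d) ∧ ∀ d ∈ D, ∀ e ∈ D, ¬ Cross d e

/-- Triangulations are the dissections that are maximal under inclusion. -/
def IsTriangulation (n : ℕ) (T : Finset (Fin n × Fin n)) : Prop :=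
  Maximal (IsDissection n) T

/-- `T'` arises from `T` by a diagonal flip: one diagonal `d` is replaced by the other diagonal `e`
of a quadrilateral, and all other diagonals are kept. -/
def IsFlip {n : ℕ} (T T' : Finset (Fin n × Fin n)) : Prop :=
  ∃ d ∈ T, ∃ e ∈ T', Cross d e ∧ T.erase d = T'.erase e

variable {E : Type*} [NormedAddCommGroup E] [InnerProductSpace ℝ E]

/-- `P` is a realization of the associahedron `A_n`: a polytope of dimension `n - 3` whose nonempty
faces correspond to the dissections of the `n`-gon, with inclusion reversed, in such a way
that the vertices correspond to the triangulations and two vertices are joined by an edge iff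
the triangulations differ by a diagonal flip. -/
def IsAssociahedron (n : ℕ) (P : Set E) : Prop :=
  IsPolytope P ∧ dim P = n - 3 ∧
    ∃ Φ : {D : Finset (Fin n × Fin n) // IsDissection n D} ≃o {F : Set E // IsFace P F}ᵒᵈ,
      (∀ D, IsTriangulation n D.1 ↔
        ∃ u, IsVertex P u ∧ (OrderDual.ofDual (Φ D)).1 = {u}) ∧
      ∀ T T', IsTriangulation n T.1 → IsTriangulation n T'.1 →
        (IsFlip T.1 T'.1 ↔ T ≠ T' ∧
          ∃ F, IsEdge P F ∧ (OrderDual.ofDual (Φ T)).1 ⊆ F ∧ (OrderDual.ofDual (Φ T')).1 ⊆ F)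

end Polygon

section TypeA

/-- The hyperplane `x_1 + ⋯ + x_m = 0` in Euclidean `m`-space, on which the reflection group of
type `A_{m-1}` (the symmetric group) acts. The coordinates are indexed by `0, …, m - 1`. -/
def sumZero (m : ℕ) : Submodule ℝ (EuclideanSpace ℝ (Fin m)) where
  carrier := {x | ∑ k, x k = 0}
  add_mem' := by
    intro x y hx hy
    simp only [Set.mem_ofPred_eq] at hx hy
    simp [Finset.sum_add_distrib, hx, hy]
  zero_mem' := by simp
  smul_mem' := by
    intro c x hx
    simp only [Set.mem_ofPred_eq] at hx
    simp [← Finset.mul_sum, hx]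

/-- The closed Weyl chamber `x_{π 1} ≥ x_{π 2} ≥ ⋯ ≥ x_{π m}`. -/
def chamber {m : ℕ} (π : Equiv.Perm (Fin m)) : Set (sumZero m) :=
  {x | ∀ a b : Fin m, a ≤ b → x.1 (π b) ≤ x.1 (π a)}

/-- The points with `x_i, …, x_j ≥ x_{i-1}, x_{j+1}`, where the inequalities that involve a
coordinate outside the index range are omitted. -/
def region {m : ℕ} (i j : Fin m) : Set (sumZero m) :=
  {x | ∀ k, i ≤ k → k ≤ j → ∀ l : Fin m,
    ((l : ℕ) + 1 = i ∨ (l : ℕ) = j + 1) → x.1 l ≤ x.1 k}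

/-- The `k`-th vertex `e_k - (1/m) (1, …, 1)` of the regular simplex with barycenter `0`. -/
noncomputable def simplexVertex {m : ℕ} (k : Fin m) : sumZero m :=
  ⟨WithLp.toLp 2 fun l => (if l = k then 1 else 0) - 1 / (m : ℝ), by
    have hm : (m : ℝ) ≠ 0 := by
      have := k.pos
      positivity
    change ∑ l, ((if l = k then (1 : ℝ) else 0) - 1 / (m : ℝ)) = 0
    simp [Finset.sum_sub_distrib, hm]⟩

/-- The ray through the barycenter of the face of the simplex spanned by the vertices
`i, i + 1, …, j`. (The sum below is a positive multiple of this barycenter.) -/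
def intervalRay {m : ℕ} (i j : Fin m) : Set (sumZero m) :=
  {x | ∃ c : ℝ, 0 ≤ c ∧ x = c • ∑ k ∈ Finset.Icc i j, simplexVertex k}

/-- `{i, …, j}` is a nonempty contiguous set of indices, and not the set of all indices. -/
def IsProperInterval {m : ℕ} (i j : Fin m) : Prop :=
  i ≤ j ∧ ¬ ((i : ℕ) = 0 ∧ (j : ℕ) + 1 = m)

end TypeA

end Associahedra

/-!
The polytope is Loday's associahedron, translated into the hyperplane of coordinate sum zero. A
diagonal `(a, b)` of the `n`-gon, `n = m + 2`, is identified with the interval `{a, …, b - 2}` of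
the coordinates `0, …, m - 1` (`arc`); two diagonals do not cross iff their intervals are nested,
or disjoint and not adjacent. The facet inequality of `d` bounds `∑ x_k`, `k ∈ arc d`, from below.

Everything rests on two facts about the dissection `nest v` of a vector `v`, which consists of the
intervals on which `v` is larger than at the adjacent coordinates.

* `exists_eq_sum_rayVector`: `v` is a positive combination of the generators `rayVector d` with
  `d` in a subset of `nest v`. It is obtained by lowering the peaks of `v` one after the other.
* `isTightPoint_lodayPoint`: the polytope is a Minkowski sum of simplices, one for each interval
  `I`, and the sum of the barycenters of the `v`-minimal faces of these simplices satisfies the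
  facet inequality of `d` with equality iff `d ∈ nest v`. As every dissection `D` is of the form
  `nest v` (`nest_depth`), there is a point that is tight for exactly the diagonals in `D`.

From these two facts alone (`IsSimplicialPresentation`) it follows, for any simplicial complex in
place of the dissections, that the faces of the polyhedron are its tight sets for the simplices, that
their normal cones are the cones over the simplices, and that the polyhedron is a simple polytope. A
linear functional `∑ c_d • rayVector d` with positive coefficients is minimal exactly where the
inequalities of all its `d` are tight, which determines all faces; points tight for exactly `D`
give the linear independence of the generators of `D`, hence all dimensions.

A vector `v` lies in the star of the ray of `d` iff it lies in the cone of a dissection that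
contains `d`. This holds iff no interval of `nest v` crosses `d`, that is, iff `v` is at least as
large on `arc d` as at the adjacent coordinates (`setOf_mem_coneOf_eq_region`). These inequalities
define a convex cone, and sorting coordinates shows that it is a union of Weyl chambers.
-/

namespace Associahedra

open Module
open scoped InnerProductSpace

/-! ### Simple polytopes with a prescribed simplicial normal fan -/

section SimplicialPresentation

variable {E : Type*} [NormedAddCommGroup E] [InnerProductSpace ℝ E] {ι : Type*}

/-- The polyhedron `⟪b e, x⟫ ≥ h e`, where `e` runs over the vertices of the simplicial
complex `𝒟`. -/
def polyhedron (𝒟 : Finset ι → Prop) (b : ι → E) (h : ι → ℝ) : Set E :=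
  {x | ∀ e, 𝒟 {e} → h e ≤ ⟪b e, x⟫_ℝ}

/-- The part of the polyhedron on which the inequalities indexed by `D` are equalities. -/
def tightFace (𝒟 : Finset ι → Prop) (b : ι → E) (h : ι → ℝ) (D : Finset ι) : Set E :=
  {x | x ∈ polyhedron 𝒟 b h ∧ ∀ e ∈ D, ⟪b e, x⟫_ℝ = h e}

/-- The cone generated by the vectors `b e` with `e ∈ D`. -/
def coneOf (b : ι → E) (D : Finset ι) : Set E :=
  {v | ∃ c : ι → ℝ, (∀ e ∈ D, 0 ≤ c e) ∧ v = ∑ e ∈ D, c e • b e}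

/-- The point `x` satisfies all inequalities of the polyhedron, with equality exactly for those
that are indexed by `D`. -/
def IsTightPoint (𝒟 : Finset ι → Prop) (b : ι → E) (h : ι → ℝ) (D : Finset ι) (x : E) : Prop :=
  ∀ e, 𝒟 {e} → h e ≤ ⟪b e, x⟫_ℝ ∧ (⟪b e, x⟫_ℝ = h e ↔ e ∈ D)

/-- The data `(b, h)` present a simple polytope whose normal fan consists of the cones over the
simplices of `𝒟`: these cones cover the whole space, and every simplex of `𝒟` is the exact set
of tight inequalities at some point of the polyhedron. -/
structure IsSimplicialPresentation (𝒟 : Finset ι → Prop) (b : ι → E) (h : ι → ℝ) : Prop where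
  mono : ∀ {D D' : Finset ι}, D' ⊆ D → 𝒟 D → 𝒟 D'
  exists_eq_sum : ∀ v : E, ∃ S, 𝒟 S ∧ ∃ c : ι → ℝ, (∀ e ∈ S, 0 < c e) ∧ v = ∑ e ∈ S, c e • b e
  exists_tight : ∀ D, 𝒟 D → ∃ x : E, IsTightPoint 𝒟 b h D x

variable {𝒟 : Finset ι → Prop} {b : ι → E} {h : ι → ℝ}

lemma coneOf_singleton (e : ι) :
    coneOf b {e} = {x | ∃ c : ℝ, 0 ≤ c ∧ x = c • b e} := by
  ext x
  constructor
  · rintro ⟨c, hc, rfl⟩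
    exact ⟨c e, hc e (by simp), by simp⟩
  · rintro ⟨c, hc, rfl⟩
    exact ⟨fun _ => c, by simpa using hc, by simp⟩

lemma span_coneOf (D : Finset ι) :
    Submodule.span ℝ (coneOf b D) = Submodule.span ℝ (b '' (D : Set ι)) := by
  classical
  apply le_antisymm <;> rw [Submodule.span_le]
  · rintro _ ⟨c, -, rfl⟩
    exact Submodule.sum_mem _ fun e he =>
      Submodule.smul_mem _ _ (Submodule.subset_span ⟨e, he, rfl⟩)
  · rintro _ ⟨e, he, rfl⟩
    refine Submodule.subset_span ⟨fun i => if i = e then 1 else 0, fun i _ => ?_, ?_⟩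
    · dsimp only; split_ifs <;> norm_num
    · simp [Finset.mem_coe.1 he]

lemma coneOf_mono {D D' : Finset ι} (hD : D ⊆ D') : coneOf b D ⊆ coneOf b D' := by
  classical
  rintro _ ⟨c, hc, rfl⟩
  refine ⟨fun e => if e ∈ D then c e else 0, fun e _ => ?_, ?_⟩
  · dsimp only; split_ifs with he
    exacts [hc e he, le_rfl]
  · rw [← Finset.sum_subset hD]
    · exact Finset.sum_congr rfl fun e he => by simp [he]
    · intro e _ he
      simp [he]

lemma mem_coneOf {D : Finset ι} {e : ι} (he : e ∈ D) : b e ∈ coneOf b D :=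
  coneOf_mono (Finset.singleton_subset_iff.2 he)
    (by rw [coneOf_singleton]; exact ⟨1, zero_le_one, by simp⟩)

lemma tightFace_anti {D D' : Finset ι} (hD : D ⊆ D') :
    tightFace 𝒟 b h D' ⊆ tightFace 𝒟 b h D :=
  fun _ hx => ⟨hx.1, fun e he => hx.2 e (hD he)⟩

namespace IsSimplicialPresentation

variable (H : IsSimplicialPresentation 𝒟 b h)
include H

lemma single {D : Finset ι} (hD : 𝒟 D) {e : ι} (he : e ∈ D) : 𝒟 {e} :=
  H.mono (Finset.singleton_subset_iff.2 he) hD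

lemma tightPoint_mem {D : Finset ι} (hD : 𝒟 D) {x : E} (hx : IsTightPoint 𝒟 b h D x) :
    x ∈ tightFace 𝒟 b h D :=
  ⟨fun e he => (hx e he).1, fun e he => ((hx e (H.single hD he)).2).2 he⟩

lemma subset_of_tightPoint_mem {D D' : Finset ι} (hD' : 𝒟 D') {x : E}
    (hx : IsTightPoint 𝒟 b h D x) (hx' : x ∈ tightFace 𝒟 b h D') : D' ⊆ D :=
  fun e he => ((hx e (H.single hD' he)).2).1 (hx'.2 e he)

lemma tightFace_subset_iff {D D' : Finset ι} (hD : 𝒟 D) (hD' : 𝒟 D') :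
    tightFace 𝒟 b h D ⊆ tightFace 𝒟 b h D' ↔ D' ⊆ D := by
  refine ⟨fun hs => ?_, tightFace_anti⟩
  obtain ⟨x, hx⟩ := H.exists_tight D hD
  exact H.subset_of_tightPoint_mem hD' hx (hs (H.tightPoint_mem hD hx))

lemma sum_le_inner {S : Finset ι} (hS : 𝒟 S) {c : ι → ℝ} (hc : ∀ e ∈ S, 0 ≤ c e) {x : E}
    (hx : x ∈ polyhedron 𝒟 b h) : ∑ e ∈ S, c e * h e ≤ ⟪∑ e ∈ S, c e • b e, x⟫_ℝ := by
  rw [sum_inner]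
  refine Finset.sum_le_sum fun e he => ?_
  rw [real_inner_smul_left]
  exact mul_le_mul_of_nonneg_left (hx e (H.single hS he)) (hc e he)

omit H in
lemma inner_eq_sum {S : Finset ι} (c : ι → ℝ) {x : E}
    (hx : x ∈ tightFace 𝒟 b h S) : ⟪∑ e ∈ S, c e • b e, x⟫_ℝ = ∑ e ∈ S, c e * h e := by
  rw [sum_inner]
  exact Finset.sum_congr rfl fun e he => by rw [real_inner_smul_left, hx.2 e he]

/-- A positive combination of the `b e`, `e ∈ S`, attains its minimum exactly on the face on
which the inequalities indexed by `S` are tight. -/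
lemma setOf_isMin {S : Finset ι} (hS : 𝒟 S) {c : ι → ℝ} (hc : ∀ e ∈ S, 0 < c e) {v : E}
    (hv : v = ∑ e ∈ S, c e • b e) :
    {x | x ∈ polyhedron 𝒟 b h ∧ ∀ y ∈ polyhedron 𝒟 b h, ⟪v, x⟫_ℝ ≤ ⟪v, y⟫_ℝ} =
      tightFace 𝒟 b h S := by
  subst hv
  have hc' : ∀ e ∈ S, 0 ≤ c e := fun e he => (hc e he).le
  ext x
  constructor
  · rintro ⟨hx, hmin⟩
    obtain ⟨y, hy⟩ := H.exists_tight S hS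
    have hy := H.tightPoint_mem hS hy
    have h1 := hmin y hy.1
    rw [inner_eq_sum c hy, sum_inner] at h1
    have h2 : ∀ e ∈ S, c e * h e ≤ ⟪c e • b e, x⟫_ℝ := fun e he => by
      rw [real_inner_smul_left]
      exact mul_le_mul_of_nonneg_left (hx e (H.single hS he)) (hc' e he)
    have h3 := (Finset.sum_eq_sum_iff_of_le h2).1 (le_antisymm (Finset.sum_le_sum h2) h1)
    refine ⟨hx, fun e he => ?_⟩
    have := h3 e he
    rw [real_inner_smul_left] at this
    exact (mul_left_cancel₀ (hc e he).ne' this).symm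
  · intro hx
    refine ⟨hx.1, fun y hy => ?_⟩
    rw [inner_eq_sum c hx]
    exact H.sum_le_inner hS hc' hy

lemma empty : 𝒟 ∅ := by
  obtain ⟨S, hS, -⟩ := H.exists_eq_sum 0
  exact H.mono (Finset.empty_subset S) hS

omit H in
lemma tightFace_empty : tightFace 𝒟 b h ∅ = polyhedron 𝒟 b h := by
  ext x
  simp [tightFace]

section Faces

lemma isFace_tightFace {D : Finset ι} (hD : 𝒟 D) :
    IsFace (polyhedron 𝒟 b h) (tightFace 𝒟 b h D) := by
  obtain ⟨x, hx⟩ := H.exists_tight D hD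
  refine ⟨⟨x, H.tightPoint_mem hD hx⟩, fun _ => ?_⟩
  refine ⟨innerSL ℝ (-∑ e ∈ D, (1 : ℝ) • b e), ?_⟩
  rw [← H.setOf_isMin hD (c := fun _ => 1) (by simp) rfl]
  simp only [innerSL_apply_apply, inner_neg_left, neg_le_neg_iff]

variable [FiniteDimensional ℝ E]

lemma isFace_iff {F : Set E} :
    IsFace (polyhedron 𝒟 b h) F ↔ ∃ D, 𝒟 D ∧ F = tightFace 𝒟 b h D := by
  constructor
  · rintro ⟨hne, hex⟩
    obtain ⟨l, hl⟩ := hex hne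
    have : CompleteSpace E := FiniteDimensional.complete ℝ E
    obtain ⟨v, rfl⟩ := (InnerProductSpace.toDual ℝ E).surjective l
    obtain ⟨S, hS, c, hc, hv⟩ := H.exists_eq_sum (-v)
    refine ⟨S, hS, ?_⟩
    rw [← H.setOf_isMin hS hc hv, hl]
    simp only [InnerProductSpace.toDual_apply_apply, inner_neg_left, neg_le_neg_iff]
  · rintro ⟨D, hD, rfl⟩
    exact H.isFace_tightFace hD

/-- The inclusion-reversing bijection from the simplices of `𝒟` to the nonempty faces. -/
noncomputable def faceOrderIso :
    {D : Finset ι // 𝒟 D} ≃o {F : Set E // IsFace (polyhedron 𝒟 b h) F}ᵒᵈ :=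
  RelIso.ofSurjective
    (OrderEmbedding.ofMapLEIff
      (fun D => OrderDual.toDual ⟨tightFace 𝒟 b h D.1, H.isFace_tightFace D.2⟩)
      fun D D' => H.tightFace_subset_iff D'.2 D.2)
    (by
      intro F
      obtain ⟨D, hD, hF⟩ := H.isFace_iff.1 (OrderDual.ofDual F).2
      exact ⟨⟨D, hD⟩, OrderDual.ofDual.injective (Subtype.ext hF.symm)⟩)

lemma faceOrderIso_apply (D : {D : Finset ι // 𝒟 D}) :
    (OrderDual.ofDual (H.faceOrderIso D)).1 = tightFace 𝒟 b h D.1 := rfl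

end Faces

section NormalFan

lemma normalCone_tightFace {D : Finset ι} (hD : 𝒟 D) :
    normalCone (polyhedron 𝒟 b h) (tightFace 𝒟 b h D) = coneOf b D := by
  ext v
  constructor
  · intro hv
    obtain ⟨S, hS, c, hc, rfl⟩ := H.exists_eq_sum v
    obtain ⟨x, hx⟩ := H.exists_tight D hD
    have hxD := H.tightPoint_mem hD hx
    have hxS : x ∈ tightFace 𝒟 b h S := by
      rw [← H.setOf_isMin hS hc rfl]
      refine ⟨hxD.1, fun y hy => ?_⟩
      rw [real_inner_comm, real_inner_comm y]
      exact hv x hxD y hy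
    exact coneOf_mono (H.subset_of_tightPoint_mem hS hx hxS) ⟨c, fun e he => (hc e he).le, rfl⟩
  · rintro ⟨c, hc, rfl⟩ u hu u' hu'
    rw [real_inner_comm, real_inner_comm _ u', inner_eq_sum c hu]
    exact H.sum_le_inner hD hc hu'

/-- The generators belonging to a simplex of `𝒟` are linearly independent: a point tight for
`D ∖ {e}` only, compared with one tight for `D`, separates `b e` from the other generators. -/
lemma linearIndepOn [DecidableEq ι] {D : Finset ι} (hD : 𝒟 D) :
    LinearIndepOn ℝ b (D : Set ι) := by
  rw [linearIndepOn_finset_iff]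
  intro f hf e he
  have hDe : 𝒟 (D.erase e) := H.mono (Finset.erase_subset e D) hD
  obtain ⟨x, hx⟩ := H.exists_tight D hD
  obtain ⟨y, hy⟩ := H.exists_tight _ hDe
  have hxD := H.tightPoint_mem hD hx
  have hyD := H.tightPoint_mem hDe hy
  have h1 : ⟪∑ i ∈ D, f i • b i, y - x⟫_ℝ = 0 := by rw [hf, inner_zero_left]
  rw [sum_inner, Finset.sum_eq_single_of_mem e he, real_inner_smul_left] at h1
  · rcases mul_eq_zero.1 h1 with h2 | h2
    · exact h2
    · rw [inner_sub_right, hxD.2 e he, sub_eq_zero] at h2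
      have := (hy e (H.single hD he)).2.1 h2
      simp at this
  · intro i hi hne
    rw [real_inner_smul_left, inner_sub_right, hxD.2 i hi,
      hyD.2 i (Finset.mem_erase.2 ⟨hne, hi⟩), sub_self, mul_zero]

lemma finrank_span [DecidableEq ι] {D : Finset ι} (hD : 𝒟 D) :
    finrank ℝ (Submodule.span ℝ (b '' (D : Set ι))) = D.card := by
  have h1 := finrank_span_eq_card (H.linearIndepOn hD)
  rw [Set.image_eq_range]
  simpa using h1

lemma coneOf_subset_iff [DecidableEq ι] {D D' : Finset ι} (hD : 𝒟 D) (hD' : 𝒟 D') :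
    coneOf b D ⊆ coneOf b D' ↔ D ⊆ D' := by
  refine ⟨fun hs e he => ?_, coneOf_mono⟩
  obtain ⟨c, hc, hce⟩ := hs (mem_coneOf he)
  obtain ⟨x, hx⟩ := H.exists_tight D' hD'
  have hxD := H.tightPoint_mem hD' hx
  have hmin : x ∈ tightFace 𝒟 b h {e} := by
    rw [← H.setOf_isMin (c := fun _ => 1) (H.single hD he) (by simp) rfl]
    refine ⟨hxD.1, fun y hy => ?_⟩
    simp only [Finset.sum_singleton, one_smul]
    rw [hce, inner_eq_sum c hxD]
    exact H.sum_le_inner hD' hc hy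
  exact H.subset_of_tightPoint_mem (H.single hD he) hx hmin (by simp)

variable [FiniteDimensional ℝ E]

lemma mem_normalFan_iff {σ : Set E} :
    σ ∈ normalFan (polyhedron 𝒟 b h) ↔ ∃ D, 𝒟 D ∧ σ = coneOf b D := by
  constructor
  · rintro ⟨F, hF, rfl⟩
    obtain ⟨D, hD, rfl⟩ := H.isFace_iff.1 hF
    exact ⟨D, hD, H.normalCone_tightFace hD⟩
  · rintro ⟨D, hD, rfl⟩
    exact ⟨_, H.isFace_tightFace hD, (H.normalCone_tightFace hD).symm⟩

lemma isRay_iff [DecidableEq ι] {ρ : Set E} :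
    IsRay (normalFan (polyhedron 𝒟 b h)) ρ ↔ ∃ e, 𝒟 {e} ∧ ρ = coneOf b {e} := by
  constructor
  · rintro ⟨hρ, hr⟩
    obtain ⟨D, hD, rfl⟩ := H.mem_normalFan_iff.1 hρ
    rw [span_coneOf, H.finrank_span hD] at hr
    obtain ⟨e, rfl⟩ := Finset.card_eq_one.1 hr
    exact ⟨e, hD, rfl⟩
  · rintro ⟨e, he, rfl⟩
    exact ⟨H.mem_normalFan_iff.2 ⟨_, he, rfl⟩, by
      rw [span_coneOf, H.finrank_span he, Finset.card_singleton]⟩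

lemma support_star [DecidableEq ι] {e : ι} (he : 𝒟 {e}) :
    support (star (normalFan (polyhedron 𝒟 b h)) (coneOf b {e})) =
      {v | ∃ D, 𝒟 D ∧ e ∈ D ∧ v ∈ coneOf b D} := by
  ext v
  constructor
  · rintro ⟨τ, ⟨-, κ, hκ, heκ, hτκ⟩, hv⟩
    obtain ⟨D, hD, rfl⟩ := H.mem_normalFan_iff.1 hκ
    exact ⟨D, hD, (H.coneOf_subset_iff he hD).1 heκ (by simp), hτκ hv⟩
  · rintro ⟨D, hD, heD, hv⟩
    have hmem := H.mem_normalFan_iff.2 ⟨D, hD, rfl⟩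
    exact ⟨coneOf b D, ⟨hmem, _, hmem, coneOf_mono (Finset.singleton_subset_iff.2 heD), subset_rfl⟩,
      hv⟩

end NormalFan

section Polytope

variable [Finite ι] [FiniteDimensional ℝ E]

lemma isPolytope : IsPolytope (polyhedron 𝒟 b h) := by
  classical
  choose! x hx using H.exists_tight
  have hfin : (x '' {D | 𝒟 D}).Finite := (Set.toFinite _).image x
  have hconv : Convex ℝ (polyhedron 𝒟 b h) := by
    intro y hy z hz s t hs ht hst e he
    rw [inner_add_right, real_inner_smul_right, real_inner_smul_right]
    have h1 := mul_le_mul_of_nonneg_left (hy e he) hs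
    have h2 := mul_le_mul_of_nonneg_left (hz e he) ht
    have h3 : h e = s * h e + t * h e := by rw [← add_mul, hst, one_mul]
    linarith
  refine ⟨_, hfin, Set.Subset.antisymm (fun y hy => ?_) ?_⟩
  · by_contra hne
    obtain ⟨l, u, hlu, hl⟩ := geometric_hahn_banach_point_closed (convex_convexHull ℝ _)
      (hfin.isClosed_convexHull ℝ) hne
    have : CompleteSpace E := FiniteDimensional.complete ℝ E
    obtain ⟨v, rfl⟩ := (InnerProductSpace.toDual ℝ E).surjective l
    obtain ⟨S, hS, c, hc, hv⟩ := H.exists_eq_sum v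
    have h1 := H.tightPoint_mem hS (hx S hS)
    rw [← H.setOf_isMin hS hc hv] at h1
    have h2 := hl (x S) (subset_convexHull ℝ _ ⟨S, hS, rfl⟩)
    have h3 := h1.2 y hy
    simp only [InnerProductSpace.toDual_apply_apply] at h2 hlu
    linarith
  · refine convexHull_min ?_ hconv
    rintro _ ⟨D, hD, rfl⟩
    exact (H.tightPoint_mem hD (hx D hD)).1

omit [FiniteDimensional ℝ E] in
/-- From a point tight for exactly `D` one can move a little in every direction that is orthogonal
to the generators of `D`. -/
lemma vectorSpan_tightFace {D : Finset ι} (hD : 𝒟 D) :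
    vectorSpan ℝ (tightFace 𝒟 b h D) = (Submodule.span ℝ (b '' (D : Set ι)))ᗮ := by
  have hspan : ∀ w : E, w ∈ (Submodule.span ℝ (b '' (D : Set ι)))ᗮ ↔
      ∀ e ∈ D, ⟪b e, w⟫_ℝ = 0 := by
    intro w
    refine ⟨fun hw e he => (Submodule.mem_orthogonal _ w).1 hw _
      (Submodule.subset_span ⟨e, he, rfl⟩), fun hw => ?_⟩
    rw [Submodule.mem_orthogonal]
    intro u hu
    induction hu using Submodule.span_induction with
    | mem u hu => obtain ⟨e, he, rfl⟩ := hu; exact hw e he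
    | zero => exact inner_zero_left w
    | add u u' _ _ h1 h2 => rw [inner_add_left, h1, h2, add_zero]
    | smul a u _ h1 => rw [real_inner_smul_left, h1, mul_zero]
  apply le_antisymm
  · rw [vectorSpan_def, Submodule.span_le]
    rintro _ ⟨x, hx, y, hy, rfl⟩
    rw [SetLike.mem_coe, hspan]
    intro e he
    change ⟪b e, x - y⟫_ℝ = 0
    rw [inner_sub_right, hx.2 e he, hy.2 e he, sub_self]
  · intro w hw
    rw [hspan] at hw
    obtain ⟨x, hx⟩ := H.exists_tight D hD
    have hev : ∀ᶠ ε in nhdsWithin (0 : ℝ) (Set.Ioi 0), x + ε • w ∈ tightFace 𝒟 b h D := by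
      have h1 : ∀ᶠ ε in nhdsWithin (0 : ℝ) (Set.Ioi 0), ∀ e, 𝒟 {e} →
          h e ≤ ⟪b e, x + ε • w⟫_ℝ := by
        rw [Filter.eventually_all]
        intro e
        by_cases he : e ∈ D
        · refine Filter.Eventually.of_forall fun ε hDe => ?_
          rw [inner_add_right, real_inner_smul_right, hw e he, mul_zero, add_zero]
          exact (hx e hDe).1
        · by_cases hDe : 𝒟 {e}
          · have hlt : h e < ⟪b e, x + (0 : ℝ) • w⟫_ℝ := by
              rw [zero_smul, add_zero]
              exact lt_of_le_of_ne (hx e hDe).1 fun h' => he ((hx e hDe).2.1 h'.symm)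
            have hcont : Continuous fun ε : ℝ => ⟪b e, x + ε • w⟫_ℝ := by fun_prop
            exact ((hcont.tendsto 0).eventually_const_lt hlt).filter_mono nhdsWithin_le_nhds
              |>.mono fun ε hε _ => hε.le
          · exact Filter.Eventually.of_forall fun ε h' => absurd h' hDe
      filter_upwards [h1] with ε hε
      refine ⟨hε, fun e he => ?_⟩
      rw [inner_add_right, real_inner_smul_right, hw e he, mul_zero, add_zero]
      exact (H.tightPoint_mem hD hx).2 e he
    obtain ⟨ε, hε, hε0⟩ := (hev.and self_mem_nhdsWithin).exists
    have h2 := vsub_mem_vectorSpan ℝ hε (H.tightPoint_mem hD hx)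
    rw [vsub_eq_sub, add_sub_cancel_left] at h2
    exact (Submodule.smul_mem_iff _ (ne_of_gt hε0)).1 h2

lemma card_add_dim_tightFace [DecidableEq ι] {D : Finset ι} (hD : 𝒟 D) :
    D.card + dim (tightFace 𝒟 b h D) = finrank ℝ E := by
  rw [dim, H.vectorSpan_tightFace hD, ← H.finrank_span hD]
  exact Submodule.finrank_add_finrank_orthogonal _

lemma dim_polyhedron : dim (polyhedron 𝒟 b h) = finrank ℝ E := by
  classical
  have := H.card_add_dim_tightFace H.empty
  rwa [tightFace_empty, Finset.card_empty, zero_add] at this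

/-- The generators of a maximal simplex `T` span the space. For a vector `w` orthogonal to all of
them, `K • ∑ b e + w` lies in the cone of some simplex `S`; if `K` is large, then the points tight
for `S` minimise `∑ b e`, whence `T ⊆ S`, so that `S = T` and `w` lies in the span. -/
lemma card_eq_finrank [DecidableEq ι] {T : Finset ι} (hT : Maximal 𝒟 T) :
    T.card = finrank ℝ E := by
  choose! x hx using H.exists_tight
  have hbot : (Submodule.span ℝ (b '' (T : Set ι)))ᗮ = ⊥ := by
    rw [Submodule.eq_bot_iff]
    intro w hw
    set v : E := ∑ e ∈ T, (1 : ℝ) • b e with hv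
    have hxT := H.tightPoint_mem hT.1 (hx T hT.1)
    have hev : ∀ᶠ K : ℝ in Filter.atTop, ∀ S, 𝒟 S → ¬ T ⊆ S →
        0 < K * ⟪v, x S - x T⟫_ℝ + ⟪w, x S - x T⟫_ℝ := by
      rw [Filter.eventually_all]
      intro S
      by_cases hS : 𝒟 S ∧ ¬ T ⊆ S
      · have hpos : 0 < ⟪v, x S - x T⟫_ℝ := by
          have hxS := H.tightPoint_mem hS.1 (hx S hS.1)
          rw [inner_sub_right, sub_pos]
          by_contra hle
          refine hS.2 (H.subset_of_tightPoint_mem hT.1 (hx S hS.1) ?_)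
          rw [← H.setOf_isMin hT.1 (c := fun _ => 1) (by simp) hv]
          refine ⟨hxS.1, fun y hy => (not_lt.1 hle).trans ?_⟩
          rw [hv, inner_eq_sum _ hxT]
          exact H.sum_le_inner hT.1 (by simp) hy
        have ht := Filter.tendsto_atTop_add_const_right Filter.atTop ⟪w, x S - x T⟫_ℝ
          (Filter.tendsto_id.atTop_mul_const hpos)
        exact (ht.eventually_gt_atTop 0).mono fun K hK _ _ => hK
      · exact Filter.Eventually.of_forall fun K h1 h2 => absurd ⟨h1, h2⟩ hS
    obtain ⟨K, hK⟩ := hev.exists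
    obtain ⟨S, hS, c, hc, hc'⟩ := H.exists_eq_sum (K • v + w)
    have hTS : T ⊆ S := by
      by_contra hTS
      have h1 := hK S hS hTS
      have h2 := H.tightPoint_mem hS (hx S hS)
      rw [← H.setOf_isMin hS hc hc'] at h2
      have h3 := h2.2 (x T) hxT.1
      rw [inner_add_left, inner_add_left, real_inner_smul_left, real_inner_smul_left] at h3
      rw [inner_sub_right, inner_sub_right] at h1
      linarith
    obtain rfl : T = S := hTS.antisymm (hT.2 hS hTS)
    have hmem : w ∈ Submodule.span ℝ (b '' (T : Set ι)) := by
      have hsum : ∀ c : ι → ℝ, ∑ e ∈ T, c e • b e ∈ Submodule.span ℝ (b '' (T : Set ι)) :=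
        fun c => Submodule.sum_mem _ fun e he =>
          Submodule.smul_mem _ _ (Submodule.subset_span ⟨e, he, rfl⟩)
      have hw' : w = (∑ e ∈ T, c e • b e) - K • v := by rw [← hc', add_sub_cancel_left]
      rw [hw']
      exact Submodule.sub_mem _ (hsum c) (Submodule.smul_mem _ _ (hsum _))
    exact inner_self_eq_zero.1 ((Submodule.mem_orthogonal _ w).1 hw w hmem)
  have h1 := Submodule.finrank_add_finrank_orthogonal (Submodule.span ℝ (b '' (T : Set ι)))
  rwa [hbot, finrank_bot, add_zero, H.finrank_span hT.1] at h1

lemma maximal_iff [DecidableEq ι] {T : Finset ι} (hT : 𝒟 T) :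
    Maximal 𝒟 T ↔ ∃ u, IsVertex (polyhedron 𝒟 b h) u ∧ tightFace 𝒟 b h T = {u} := by
  constructor
  · intro hmax
    have h1 := H.card_add_dim_tightFace hT
    rw [H.card_eq_finrank hmax, Nat.add_eq_left, dim, Submodule.finrank_eq_zero,
      vectorSpan_eq_bot_iff_subsingleton] at h1
    obtain ⟨u, hu⟩ := (H.isFace_tightFace hT).1
    have h2 : tightFace 𝒟 b h T = {u} := h1.eq_singleton_of_mem hu
    have h3 := H.isFace_tightFace hT
    rw [h2] at h3
    exact ⟨u, h3, h2⟩
  · rintro ⟨u, -, hu⟩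
    refine ⟨hT, fun S hS hTS => ?_⟩
    have h1 := tightFace_anti (𝒟 := 𝒟) (b := b) (h := h) hTS
    rw [hu] at h1
    rw [← H.tightFace_subset_iff hT hS, hu]
    obtain ⟨z, hz⟩ := (H.isFace_tightFace hS).1
    have := h1 hz
    rw [Set.mem_singleton_iff] at this
    subst this
    simpa using hz

lemma isEdge_iff [DecidableEq ι] {F : Set E} :
    IsEdge (polyhedron 𝒟 b h) F ↔
      ∃ D, 𝒟 D ∧ F = tightFace 𝒟 b h D ∧ D.card + 1 = finrank ℝ E := by
  constructor
  · rintro ⟨hF, hdim⟩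
    obtain ⟨D, hD, rfl⟩ := H.isFace_iff.1 hF
    exact ⟨D, hD, rfl, hdim ▸ H.card_add_dim_tightFace hD⟩
  · rintro ⟨D, hD, rfl, hc⟩
    refine ⟨H.isFace_tightFace hD, ?_⟩
    have := H.card_add_dim_tightFace hD
    lia

/-- The edges at the vertex of a maximal simplex `T` are obtained by dropping one element
of `T`. -/
lemma isSimple : IsSimple (polyhedron 𝒟 b h) := by
  classical
  intro u hu
  obtain ⟨T, hT, hTu⟩ := H.isFace_iff.1 hu
  have hmax : Maximal 𝒟 T := (H.maximal_iff hT).2 ⟨u, hu, hTu.symm⟩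
  have hcard := H.card_eq_finrank hmax
  have hset : {F : Set E | IsEdge (polyhedron 𝒟 b h) F ∧ u ∈ F} =
      (fun e => tightFace 𝒟 b h (T.erase e)) '' (T : Set ι) := by
    ext F
    constructor
    · rintro ⟨hF, huF⟩
      obtain ⟨D, hD, rfl, hDc⟩ := H.isEdge_iff.1 hF
      have hDT : D ⊆ T := by
        rw [← H.tightFace_subset_iff hT hD, ← hTu]
        simpa using huF
      have h1 : (T \ D).card = 1 := by
        rw [Finset.card_sdiff_of_subset hDT]
        lia
      obtain ⟨e, he⟩ := Finset.card_eq_one.1 h1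
      have heT : e ∈ T \ D := by simp [he]
      refine ⟨e, (Finset.mem_sdiff.1 heT).1, ?_⟩
      dsimp only
      rw [← Finset.sdiff_singleton_eq_erase, ← he, Finset.sdiff_sdiff_eq_self hDT]
    · rintro ⟨e, he, rfl⟩
      have hTe : 𝒟 (T.erase e) := H.mono (Finset.erase_subset e T) hT
      refine ⟨H.isEdge_iff.2 ⟨_, hTe, rfl, ?_⟩, ?_⟩
      · rw [Finset.card_erase_add_one he, hcard]
      · exact tightFace_anti (Finset.erase_subset e T) (hTu ▸ Set.mem_singleton u)
  rw [hset, Set.InjOn.encard_image, Set.encard_coe_eq_coe_finsetCard, hcard, H.dim_polyhedron]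
  intro e he e' he' hee
  have hTe : ∀ e, 𝒟 (T.erase e) := fun e => H.mono (Finset.erase_subset e T) hT
  have h1 := (H.tightFace_subset_iff (hTe e) (hTe e')).1 hee.le
  by_contra hne
  have h2 := h1 (Finset.mem_erase.2 ⟨hne, he⟩)
  simp at h2

lemma exists_edge_iff [DecidableEq ι] {T T' : Finset ι} (hT : 𝒟 T) (hT' : 𝒟 T') :
    (∃ F, IsEdge (polyhedron 𝒟 b h) F ∧ tightFace 𝒟 b h T ⊆ F ∧ tightFace 𝒟 b h T' ⊆ F) ↔
      ∃ D, D ⊆ T ∧ D ⊆ T' ∧ D.card + 1 = finrank ℝ E := by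
  constructor
  · rintro ⟨F, hF, h1, h2⟩
    obtain ⟨D, hD, rfl, hDc⟩ := H.isEdge_iff.1 hF
    exact ⟨D, (H.tightFace_subset_iff hT hD).1 h1, (H.tightFace_subset_iff hT' hD).1 h2, hDc⟩
  · rintro ⟨D, h1, h2, hDc⟩
    exact ⟨_, H.isEdge_iff.2 ⟨D, H.mono h1 hT, rfl, hDc⟩, tightFace_anti h1, tightFace_anti h2⟩

end Polytope

end IsSimplicialPresentation

end SimplicialPresentation

/-! ### Diagonals as intervals, and nested sets -/

section Intervals

variable {m : ℕ}

/-- The interval of coordinates that belongs to the diagonal `(a, b)` of the `(m + 2)`-gon: the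
vertices strictly between `a` and `b`, shifted by one. -/
def arc (d : Fin (m + 2) × Fin (m + 2)) : Finset (Fin m) :=
  Finset.univ.filter fun k => (d.1 : ℕ) ≤ k ∧ (k : ℕ) + 1 < d.2

/-- The at most two coordinates that are adjacent to the interval of a diagonal. -/
def arcBoundary (d : Fin (m + 2) × Fin (m + 2)) : Finset (Fin m) :=
  Finset.univ.filter fun l => (l : ℕ) + 1 = d.1 ∨ (l : ℕ) + 1 = d.2

lemma mem_arc {d : Fin (m + 2) × Fin (m + 2)} {k : Fin m} :
    k ∈ arc d ↔ (d.1 : ℕ) ≤ k ∧ (k : ℕ) + 1 < d.2 := by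
  simp [arc]

lemma mem_arcBoundary {d : Fin (m + 2) × Fin (m + 2)} {l : Fin m} :
    l ∈ arcBoundary d ↔ (l : ℕ) + 1 = d.1 ∨ (l : ℕ) + 1 = d.2 := by
  simp [arcBoundary]

lemma isDiagonal_iff {d : Fin (m + 2) × Fin (m + 2)} :
    IsDiagonal (m + 2) d ↔ (d.1 : ℕ) + 1 < d.2 ∧ ¬ ((d.1 : ℕ) = 0 ∧ (d.2 : ℕ) = m + 1) := by
  unfold IsDiagonal
  lia

lemma IsDiagonal.arcBoundary_nonempty {d : Fin (m + 2) × Fin (m + 2)}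
    (hd : IsDiagonal (m + 2) d) : (arcBoundary d).Nonempty := by
  have h1 := isDiagonal_iff.1 hd
  by_cases h0 : (d.1 : ℕ) = 0
  · exact ⟨⟨d.2 - 1, by lia⟩, mem_arcBoundary.2 (Or.inr (by dsimp only; lia))⟩
  · exact ⟨⟨d.1 - 1, by lia⟩, mem_arcBoundary.2 (Or.inl (by dsimp only; lia))⟩

lemma notMem_arc_of_mem_arcBoundary {d : Fin (m + 2) × Fin (m + 2)}
    (hd : IsDiagonal (m + 2) d) {l : Fin m} (hl : l ∈ arcBoundary d) : l ∉ arc d := by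
  have := isDiagonal_iff.1 hd
  rw [mem_arcBoundary] at hl
  rw [mem_arc]
  lia

lemma cross_iff {d e : Fin (m + 2) × Fin (m + 2)} :
    Cross d e ↔ ((d.1 : ℕ) < e.1 ∧ (e.1 : ℕ) < d.2 ∧ (d.2 : ℕ) < e.2) ∨
      ((e.1 : ℕ) < d.1 ∧ (d.1 : ℕ) < e.2 ∧ (e.2 : ℕ) < d.2) := by
  simp only [Cross, Fin.lt_def]

lemma Cross.symm {d e : Fin (m + 2) × Fin (m + 2)} (h : Cross d e) : Cross e d :=
  Or.symm h

lemma not_cross_self (d : Fin (m + 2) × Fin (m + 2)) : ¬ Cross d d := by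
  rw [cross_iff]
  lia

/-- Two diagonals cross iff each of the two intervals contains a coordinate adjacent to the other
interval. -/
lemma Cross.exists_mem {d e : Fin (m + 2) × Fin (m + 2)} (h : Cross d e) :
    (∃ k ∈ arc d, k ∈ arcBoundary e) ∧ ∃ l ∈ arc e, l ∈ arcBoundary d := by
  simp only [mem_arc, mem_arcBoundary]
  rw [cross_iff] at h
  rcases h with h | h
  · exact ⟨⟨⟨e.1 - 1, by lia⟩, by dsimp only; lia, by dsimp only; lia⟩,
      ⟨⟨d.2 - 1, by lia⟩, by dsimp only; lia, by dsimp only; lia⟩⟩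
  · exact ⟨⟨⟨e.2 - 1, by lia⟩, by dsimp only; lia, by dsimp only; lia⟩,
      ⟨⟨d.1 - 1, by lia⟩, by dsimp only; lia, by dsimp only; lia⟩⟩

lemma mem_arc_of_not_cross {d e : Fin (m + 2) × Fin (m + 2)} (h : ¬ Cross d e) {l k : Fin m}
    (hl : l ∈ arcBoundary d) (hle : l ∈ arc e) (hk : k ∈ arc d) : k ∈ arc e := by
  rw [mem_arc] at *
  rw [mem_arcBoundary] at hl
  rw [cross_iff] at h
  lia

lemma isDissection_mono {n : ℕ} {D D' : Finset (Fin n × Fin n)} (h : D' ⊆ D)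
    (hD : IsDissection n D) : IsDissection n D' :=
  ⟨fun d hd => hD.1 d (h hd), fun d hd e he => hD.2 d (h hd) e (h he)⟩

lemma isDissection_singleton {d : Fin (m + 2) × Fin (m + 2)} :
    IsDissection (m + 2) {d} ↔ IsDiagonal (m + 2) d := by
  simp [IsDissection, not_cross_self]

lemma isDissection_insert {D : Finset (Fin (m + 2) × Fin (m + 2))}
    {d : Fin (m + 2) × Fin (m + 2)} (hD : IsDissection (m + 2) D) (hd : IsDiagonal (m + 2) d)
    (hc : ∀ e ∈ D, ¬ Cross d e) : IsDissection (m + 2) (insert d D) := by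
  refine ⟨?_, ?_⟩
  · simp only [Finset.mem_insert, forall_eq_or_imp]
    exact ⟨hd, hD.1⟩
  · simp only [Finset.mem_insert, forall_eq_or_imp]
    exact ⟨⟨not_cross_self d, hc⟩, fun e he => ⟨fun h => hc e he h.symm, hD.2 e he⟩⟩

open Classical in
/-- The dissection of a vector `v`: the intervals on which `v` is strictly larger than at the
adjacent coordinates. These are the connected components of the superlevel sets of `v`. -/
noncomputable def nest (v : Fin m → ℝ) : Finset (Fin (m + 2) × Fin (m + 2)) :=
  Finset.univ.filter fun d =>
    IsDiagonal (m + 2) d ∧ ∀ k ∈ arc d, ∀ l ∈ arcBoundary d, v l < v k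

lemma mem_nest {v : Fin m → ℝ} {d : Fin (m + 2) × Fin (m + 2)} :
    d ∈ nest v ↔ IsDiagonal (m + 2) d ∧ ∀ k ∈ arc d, ∀ l ∈ arcBoundary d, v l < v k := by
  simp [nest]

lemma isDissection_nest (v : Fin m → ℝ) : IsDissection (m + 2) (nest v) := by
  refine ⟨fun d hd => (mem_nest.1 hd).1, fun d hd e he hc => ?_⟩
  obtain ⟨⟨k, hk, hk'⟩, l, hl, hl'⟩ := hc.exists_mem
  exact lt_asymm ((mem_nest.1 hd).2 k hk l hl') ((mem_nest.1 he).2 l hl k hk')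

/-- A coordinate satisfying `A` lies in a maximal interval of coordinates satisfying `A`. -/
lemma exists_maximal_arc (A : Fin m → Prop) {k : Fin m} (hk : A k) :
    ∃ d : Fin (m + 2) × Fin (m + 2), k ∈ arc d ∧ (∀ l ∈ arc d, A l) ∧
      ∀ l ∈ arcBoundary d, ¬ A l := by
  classical
  set s : Finset (Fin (m + 2) × Fin (m + 2)) :=
    Finset.univ.filter fun d => k ∈ arc d ∧ ∀ l ∈ arc d, A l with hs
  have hne : s.Nonempty := by
    refine ⟨(⟨k, by lia⟩, ⟨k + 2, by lia⟩), ?_⟩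
    simp only [hs, Finset.mem_filter, Finset.mem_univ, true_and, mem_arc]
    refine ⟨by lia, fun l hl => ?_⟩
    obtain rfl : l = k := Fin.ext (by lia)
    exact hk
  obtain ⟨d, hd, hmax⟩ := s.exists_max_image (fun d => (d.2 : ℕ) - d.1) hne
  simp only [hs, Finset.mem_filter, Finset.mem_univ, true_and] at hd hmax
  refine ⟨d, hd.1, hd.2, fun l hl hA => ?_⟩
  have h1 := mem_arc.1 hd.1
  rw [mem_arcBoundary] at hl
  rcases hl with hl | hl
  · have h2 := hmax (⟨l, by lia⟩, d.2) ⟨mem_arc.2 (by dsimp only; lia), fun i hi => ?_⟩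
    · dsimp only at h2; lia
    · rw [mem_arc] at hi
      by_cases hil : i = l
      · exact hil ▸ hA
      · have : (i : ℕ) ≠ l := fun h => hil (Fin.ext h)
        exact hd.2 i (mem_arc.2 (by dsimp only at hi; lia))
  · have h2 := hmax (d.1, ⟨l + 2, by lia⟩) ⟨mem_arc.2 (by dsimp only; lia), fun i hi => ?_⟩
    · dsimp only at h2; lia
    · rw [mem_arc] at hi
      by_cases hil : i = l
      · exact hil ▸ hA
      · have : (i : ℕ) ≠ l := fun h => hil (Fin.ext h)
        exact hd.2 i (mem_arc.2 (by dsimp only at hi; lia))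

/-- Every vector is, up to a constant, a positive combination of indicator vectors of intervals of
its dissection. A component of the set where `v` is maximal is lowered to the level of its higher
neighbour, which removes this interval from the dissection and adds none. -/
lemma exists_eq_sum_indicator (v : Fin m → ℝ) :
    ∃ S ⊆ nest v, ∃ c : Fin (m + 2) × Fin (m + 2) → ℝ, (∀ e ∈ S, 0 < c e) ∧
      ∃ t : ℝ, ∀ k, v k = t + ∑ e ∈ S, c e * (if k ∈ arc e then 1 else 0) := by
  induction hN : (nest v).card using Nat.strong_induction_on generalizing v with
  | _ N ih =>
  by_cases hconst : ∀ k l, v k = v l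
  · rcases isEmpty_or_nonempty (Fin m) with hm | ⟨⟨k0⟩⟩
    · exact ⟨∅, by simp, fun _ => 1, by simp, 0, fun k => (hm.false k).elim⟩
    · exact ⟨∅, by simp, fun _ => 1, by simp, v k0, fun k => by simpa using hconst k k0⟩
  push Not at hconst
  obtain ⟨k1, l1, hkl⟩ := hconst
  have : Nonempty (Fin m) := ⟨k1⟩
  obtain ⟨k0, hk0⟩ := Finite.exists_max v
  obtain ⟨J, hkJ, hJ, hJb⟩ := exists_maximal_arc (fun k => v k = v k0) rfl
  have hJd : IsDiagonal (m + 2) J := by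
    have h1 := mem_arc.1 hkJ
    refine isDiagonal_iff.2 ⟨by lia, fun h2 => hkl ?_⟩
    rw [hJ k1 (mem_arc.2 (by lia)), hJ l1 (mem_arc.2 (by lia))]
  obtain ⟨l0, hl0, hl0max⟩ := (arcBoundary J).exists_max_image v hJd.arcBoundary_nonempty
  have hlt : v l0 < v k0 := lt_of_le_of_ne (hk0 l0) (hJb l0 hl0)
  set v' : Fin m → ℝ := fun k => v k - (v k0 - v l0) * (if k ∈ arc J then 1 else 0) with hv'
  have hv'in : ∀ k ∈ arc J, v' k = v l0 := fun k hk => by simp [hv', hk, hJ k hk]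
  have hv'out : ∀ k, k ∉ arc J → v' k = v k := fun k hk => by simp [hv', hk]
  have hv'le : ∀ k, v' k ≤ v k := fun k => by
    by_cases hk : k ∈ arc J
    · rw [hv'in k hk, hJ k hk]; exact hlt.le
    · rw [hv'out k hk]
  have hJmem : J ∈ nest v := mem_nest.2 ⟨hJd, fun k hk l hl =>
    (hJ k hk).symm ▸ lt_of_le_of_ne (hk0 l) (hJb l hl)⟩
  have hl0J : ∀ l ∈ arcBoundary J, l ∉ arc J := fun l hl => notMem_arc_of_mem_arcBoundary hJd hl
  have hJnot : J ∉ nest v' := fun h => by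
    have h1 := (mem_nest.1 h).2 k0 hkJ l0 hl0
    rw [hv'in k0 hkJ, hv'out l0 (hl0J l0 hl0)] at h1
    exact lt_irrefl _ h1
  have hsub : nest v' ⊆ nest v := fun K hK => by
    obtain ⟨hKd, hK⟩ := mem_nest.1 hK
    refine mem_nest.2 ⟨hKd, fun k hk l hl => ?_⟩
    by_cases hlJ : l ∈ arc J
    · exfalso
      -- `K` meets `J` or its boundary next to `l`, where `v'` is at most `v l0 = v' l`
      have hex : ∃ i ∈ arc K, i ∈ arc J ∨ i ∈ arcBoundary J := by
        have h1 := isDiagonal_iff.1 hKd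
        rw [mem_arc] at hlJ
        rw [mem_arcBoundary] at hl
        rcases hl with hl | hl
        · exact ⟨⟨K.1, by lia⟩, mem_arc.2 (by dsimp only; lia), by
            rw [mem_arc, mem_arcBoundary]; dsimp only; lia⟩
        · exact ⟨⟨K.2 - 2, by lia⟩, mem_arc.2 (by dsimp only; lia), by
            rw [mem_arc, mem_arcBoundary]; dsimp only; lia⟩
      obtain ⟨i, hi, hiJ⟩ := hex
      have h1 := hK i hi l hl
      rw [hv'in l hlJ] at h1
      rcases hiJ with hiJ | hiJ
      · rw [hv'in i hiJ] at h1; exact lt_irrefl _ h1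
      · rw [hv'out i (hl0J i hiJ)] at h1; exact absurd (hl0max i hiJ) (not_le.2 h1)
    · rw [← hv'out l hlJ]
      exact (hK k hk l hl).trans_le (hv'le k)
  obtain ⟨S, hS, c, hc, t, ht⟩ := ih (nest v').card
    (hN ▸ Finset.card_lt_card ⟨hsub, fun h => hJnot (h hJmem)⟩) v' rfl
  have hJS : J ∉ S := fun h => hJnot (hS h)
  refine ⟨insert J S, Finset.insert_subset hJmem (hS.trans hsub),
    fun e => if e = J then v k0 - v l0 else c e, ?_, t, fun k => ?_⟩
  · intro e he
    dsimp only
    split_ifs with heJ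
    · exact sub_pos.2 hlt
    · exact hc e (Finset.mem_of_mem_insert_of_ne he heJ)
  · dsimp only
    have h1 : v k = v' k + (v k0 - v l0) * (if k ∈ arc J then 1 else 0) := by
      simp only [hv', sub_add_cancel]
    rw [Finset.sum_insert hJS, if_pos rfl, h1, ht k]
    have h2 : ∀ e ∈ S, (if e = J then v k0 - v l0 else c e) * (if k ∈ arc e then (1 : ℝ) else 0) =
        c e * (if k ∈ arc e then 1 else 0) := fun e he => by
      have heJ : e ≠ J := fun h => hJS (h ▸ he)
      rw [if_neg heJ]
    rw [Finset.sum_congr rfl h2]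
    ring

/-- The number of members of `D` whose interval contains a given coordinate. -/
def depth (D : Finset (Fin (m + 2) × Fin (m + 2))) (k : Fin m) : ℝ :=
  ((D.filter fun e => k ∈ arc e).card : ℝ)

/-- If `d` crosses no member of the dissection `D`, then the members of `D` that are smaller than
`d` do not cover the interval of `d`. -/
lemma exists_uncovered {D : Finset (Fin (m + 2) × Fin (m + 2))} (hD : IsDissection (m + 2) D)
    {d : Fin (m + 2) × Fin (m + 2)} (hd : IsDiagonal (m + 2) d) (hc : ∀ e ∈ D, ¬ Cross d e) :
    ∃ k ∈ arc d, ∀ e ∈ D, e ≠ d → k ∈ arc e → arc d ⊆ arc e ∧ ∃ l ∈ arcBoundary d, l ∈ arc e := by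
  classical
  -- the uncovered coordinate is the one that follows the longest smaller interval with the same
  -- left end as `d`, or the left end itself if there is no such interval
  set s : Finset (Fin (m + 2)) :=
    Finset.univ.filter fun r => (r : ℕ) < d.2 ∧ ((r : ℕ) = d.1 + 1 ∨ (d.1, r) ∈ D) with hs
  have h1 := isDiagonal_iff.1 hd
  have hne : s.Nonempty := ⟨⟨d.1 + 1, by lia⟩, by
    simp only [hs, Finset.mem_filter, Finset.mem_univ, true_and, true_or, and_true]
    lia⟩
  obtain ⟨r, hr, hmax⟩ := s.exists_max_image (fun r => (r : ℕ)) hne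
  simp only [hs, Finset.mem_filter, Finset.mem_univ, true_and] at hr hmax
  have hr1 : (d.1 : ℕ) + 1 ≤ r := by
    rcases hr.2 with h | h
    · lia
    · have := isDiagonal_iff.1 (hD.1 _ h)
      dsimp only at this; lia
  refine ⟨⟨r - 1, by lia⟩, mem_arc.2 (by dsimp only; lia), fun e he hed hke => ?_⟩
  rw [mem_arc] at hke
  dsimp only at hke
  have hce := hc e he
  rw [cross_iff] at hce
  have hcr : (d.1, r) ∈ D → ¬ Cross (d.1, r) e := fun h => hD.2 _ h e he
  rw [cross_iff] at hcr
  have hre : e.1 = d.1 → (e.2 : ℕ) < d.2 → (e.2 : ℕ) ≤ r := fun h h' =>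
    hmax e.2 ⟨h', Or.inr (by rw [← h]; exact he)⟩
  have hne' : ¬ ((e.1 : ℕ) = d.1 ∧ (e.2 : ℕ) = d.2) := fun h =>
    hed (Prod.ext (Fin.ext h.1) (Fin.ext h.2))
  have h3 : (e.1 : ℕ) ≤ d.1 := by
    rcases hr.2 with h | h
    · lia
    · have := hcr h
      dsimp only at this; lia
  have h4 : (d.2 : ℕ) ≤ e.2 := by
    by_contra h4
    by_cases h5 : (e.1 : ℕ) = d.1
    · have := hre (Fin.ext h5) (by lia); lia
    · lia
  refine ⟨fun i hi => ?_, ?_⟩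
  · rw [mem_arc] at *; lia
  · by_cases h5 : (e.1 : ℕ) = d.1
    · exact ⟨⟨d.2 - 1, by lia⟩, mem_arcBoundary.2 (by dsimp only; lia),
        mem_arc.2 (by dsimp only; lia)⟩
    · exact ⟨⟨d.1 - 1, by lia⟩, mem_arcBoundary.2 (by dsimp only; lia),
        mem_arc.2 (by dsimp only; lia)⟩

/-- Every dissection is the dissection of a vector. -/
lemma nest_depth {D : Finset (Fin (m + 2) × Fin (m + 2))} (hD : IsDissection (m + 2) D) :
    nest (depth D) = D := by
  have hsub : D ⊆ nest (depth D) := fun d hd => by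
    have hdd := hD.1 d hd
    refine mem_nest.2 ⟨hdd, fun k hk l hl => ?_⟩
    unfold depth
    have hld : l ∉ arc d := notMem_arc_of_mem_arcBoundary hdd hl
    rw [Nat.cast_lt]
    refine Finset.card_lt_card ⟨fun e he => ?_, fun h => ?_⟩
    · rw [Finset.mem_filter] at he ⊢
      exact ⟨he.1, mem_arc_of_not_cross (hD.2 d hd e he.1) hl he.2 hk⟩
    · exact hld (Finset.mem_filter.1 (h (Finset.mem_filter.2 ⟨hd, hk⟩))).2
  refine Finset.Subset.antisymm (fun d hd => ?_) hsub
  by_contra hdD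
  have hdiss := isDissection_nest (depth D)
  obtain ⟨hdd, hlt⟩ := mem_nest.1 hd
  have hc : ∀ e ∈ D, ¬ Cross d e := fun e he => hdiss.2 d hd e (hsub he)
  obtain ⟨k, hk, hcov⟩ := exists_uncovered hD hdd hc
  -- the members of `D` around `k` are larger than `d`; were each boundary coordinate of `d` missed
  -- by one of them, two such members would cross
  have hmiss : ∀ l ∈ arcBoundary d, ∃ e ∈ D, k ∈ arc e ∧ l ∉ arc e := fun l hl => by
    have h1 := hlt k hk l hl
    unfold depth at h1
    rw [Nat.cast_lt] at h1
    by_contra hcon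
    push Not at hcon
    refine absurd (Finset.card_le_card fun e he => ?_) (not_le.2 h1)
    rw [Finset.mem_filter] at he ⊢
    exact ⟨he.1, hcon e he.1 he.2⟩
  have hbig : ∀ e ∈ D, k ∈ arc e → arc d ⊆ arc e ∧ ∃ l ∈ arcBoundary d, l ∈ arc e :=
    fun e he hke => hcov e he (fun h => hdD (h ▸ he)) hke
  obtain ⟨l, hl⟩ := hdd.arcBoundary_nonempty
  obtain ⟨e, he, hke, hle⟩ := hmiss l hl
  obtain ⟨-, l', hl', hle'⟩ := hbig e he hke
  obtain ⟨e', he', hke', hle2⟩ := hmiss l' hl'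
  obtain ⟨-, l2, hl2, hle3⟩ := hbig e' he' hke'
  have hx := hD.2 e he e' he'
  rw [cross_iff] at hx
  rw [mem_arc] at *
  rw [mem_arcBoundary] at *
  have h1 := isDiagonal_iff.1 hdd
  lia

end Intervals

/-! ### Loday's realization -/

section Loday

variable {m : ℕ}

lemma sum_coe_eq_zero (x : sumZero m) : ∑ k, x.1 k = 0 := x.2

lemma inner_simplexVertex (k : Fin m) (x : sumZero m) : ⟪simplexVertex k, x⟫_ℝ = x.1 k := by
  have hx := sum_coe_eq_zero x
  have h1 : ⟪simplexVertex k, x⟫_ℝ =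
      ∑ l, x.1 l * ((if l = k then (1 : ℝ) else 0) - 1 / (m : ℝ)) := rfl
  rw [h1]
  simp only [mul_sub, Finset.sum_sub_distrib, ← Finset.sum_mul, hx]
  simp

lemma inner_smul_sumZero (x y : sumZero m) (c : ℝ) : ⟪x, c • y⟫_ℝ = c * ⟪x, y⟫_ℝ :=
  real_inner_smul_right x y c

/-- The generator of the ray that belongs to a diagonal. -/
noncomputable def rayVector (d : Fin (m + 2) × Fin (m + 2)) : sumZero m :=
  ∑ k ∈ arc d, simplexVertex k

lemma inner_rayVector_simplexVertex (d : Fin (m + 2) × Fin (m + 2)) (k : Fin m) :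
    ⟪rayVector d, simplexVertex k⟫_ℝ = (if k ∈ arc d then 1 else 0) - (arc d).card / (m : ℝ) := by
  rw [rayVector, sum_inner]
  simp only [inner_simplexVertex]
  change ∑ l ∈ arc d, ((if l = k then (1 : ℝ) else 0) - 1 / (m : ℝ)) = _
  simp [Finset.sum_sub_distrib, div_eq_mul_inv]

lemma rayVector_apply (d : Fin (m + 2) × Fin (m + 2)) (k : Fin m) :
    (rayVector d).1 k = (if k ∈ arc d then 1 else 0) - (arc d).card / (m : ℝ) := by
  rw [← inner_rayVector_simplexVertex, real_inner_comm, inner_simplexVertex]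

lemma sum_smul_rayVector_apply (S : Finset (Fin (m + 2) × Fin (m + 2)))
    (c : Fin (m + 2) × Fin (m + 2) → ℝ) (k : Fin m) :
    (∑ e ∈ S, c e • rayVector e).1 k =
      ∑ e ∈ S, c e * (if k ∈ arc e then 1 else 0) - ∑ e ∈ S, c e * ((arc e).card / (m : ℝ)) := by
  rw [← inner_simplexVertex, inner_sum, ← Finset.sum_sub_distrib]
  refine Finset.sum_congr rfl fun e _ => ?_
  rw [inner_smul_sumZero, inner_simplexVertex, rayVector_apply, mul_sub]

lemma exists_eq_sum_rayVector (v : sumZero m) :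
    ∃ S ⊆ nest v.1.ofLp, ∃ c : Fin (m + 2) × Fin (m + 2) → ℝ, (∀ e ∈ S, 0 < c e) ∧
      v = ∑ e ∈ S, c e • rayVector e := by
  obtain ⟨S, hS, c, hc, t, ht⟩ := exists_eq_sum_indicator v.1.ofLp
  refine ⟨S, hS, c, hc, ?_⟩
  -- both sides differ by a constant vector, which vanishes as its coordinates add up to zero
  set w := ∑ e ∈ S, c e • rayVector e with hw
  set s := t + ∑ e ∈ S, c e * ((arc e).card / (m : ℝ)) with hs
  have h1 : ∀ k, v.1 k = w.1 k + s := fun k => by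
    rw [ht k, hw, sum_smul_rayVector_apply, hs]
    ring
  have h2 := sum_coe_eq_zero v
  simp only [h1, Finset.sum_add_distrib, sum_coe_eq_zero w, zero_add, Finset.sum_const,
    Finset.card_univ, Fintype.card_fin, nsmul_eq_mul] at h2
  refine Subtype.ext (PiLp.ext fun k => ?_)
  have hm : (m : ℝ) ≠ 0 := by
    have := k.pos
    positivity
  rw [h1 k, (mul_eq_zero.1 h2).resolve_left hm, add_zero]

open Classical in
/-- The coordinates in `I` at which `v` attains its minimum over `I`. -/
noncomputable def argminOn (v : Fin m → ℝ) (I : Finset (Fin m)) : Finset (Fin m) :=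
  I.filter fun k => ∀ l ∈ I, v k ≤ v l

lemma mem_argminOn {v : Fin m → ℝ} {I : Finset (Fin m)} {k : Fin m} :
    k ∈ argminOn v I ↔ k ∈ I ∧ ∀ l ∈ I, v k ≤ v l := by
  simp [argminOn]

lemma argminOn_nonempty (v : Fin m → ℝ) {I : Finset (Fin m)} (hI : I.Nonempty) :
    (argminOn v I).Nonempty := by
  obtain ⟨k, hk, hmin⟩ := I.exists_min_image v hI
  exact ⟨k, mem_argminOn.2 ⟨hk, hmin⟩⟩

/-- The nonempty intervals `{i, …, j}` of coordinates, encoded as pairs `i ≤ j`. -/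
def intervals (m : ℕ) : Finset (Fin m × Fin m) :=
  Finset.univ.filter fun p => p.1 ≤ p.2

lemma mem_intervals {p : Fin m × Fin m} : p ∈ intervals m ↔ p.1 ≤ p.2 := by
  simp [intervals]

/-- Loday's associahedron is the Minkowski sum of the simplices spanned by the `simplexVertex k`,
`k ∈ I`, over all intervals `I`. This point is the sum of the barycenters of the faces of these
simplices on which `v` is minimal. -/
noncomputable def lodayPoint (v : Fin m → ℝ) : sumZero m :=
  ∑ p ∈ intervals m, ∑ k ∈ argminOn v (Finset.Icc p.1 p.2),
    ((argminOn v (Finset.Icc p.1 p.2)).card : ℝ)⁻¹ • simplexVertex k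

/-- The right-hand side of the facet inequality of `d`. Up to the normalization to coordinate sum
zero, it is the number of intervals contained in the interval of `d`. -/
noncomputable def lodayBound (d : Fin (m + 2) × Fin (m + 2)) : ℝ :=
  ∑ p ∈ intervals m,
    ((if Finset.Icc p.1 p.2 ⊆ arc d then 1 else 0) - (arc d).card / (m : ℝ))

lemma inner_lodayPoint (v : Fin m → ℝ) (d : Fin (m + 2) × Fin (m + 2)) :
    ⟪rayVector d, lodayPoint v⟫_ℝ = ∑ p ∈ intervals m,
      ((argminOn v (Finset.Icc p.1 p.2) ∩ arc d).card /
        ((argminOn v (Finset.Icc p.1 p.2)).card : ℝ) - (arc d).card / (m : ℝ)) := by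
  rw [lodayPoint, inner_sum]
  refine Finset.sum_congr rfl fun p hp => ?_
  have hne := argminOn_nonempty v (Finset.nonempty_Icc.2 (mem_intervals.1 hp))
  have hpos : ((argminOn v (Finset.Icc p.1 p.2)).card : ℝ) ≠ 0 :=
    Nat.cast_ne_zero.2 hne.card_ne_zero
  simp only [inner_sum, inner_smul_sumZero, inner_rayVector_simplexVertex, ← Finset.mul_sum,
    Finset.sum_sub_distrib, Finset.sum_const, nsmul_eq_mul, Finset.sum_boole,
    Finset.filter_mem_eq_inter]
  field_simp

lemma indicator_le_card_div {A I J : Finset (Fin m)} (hA : A.Nonempty) (hAI : A ⊆ I) :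
    (if I ⊆ J then (1 : ℝ) else 0) ≤ (A ∩ J).card / (A.card : ℝ) := by
  split_ifs with h
  · rw [Finset.inter_eq_left.2 (hAI.trans h), div_self (Nat.cast_ne_zero.2 hA.card_ne_zero)]
  · positivity

lemma indicator_eq_card_div_iff {A I J : Finset (Fin m)} (hA : A.Nonempty) (hAI : A ⊆ I) :
    (if I ⊆ J then (1 : ℝ) else 0) = (A ∩ J).card / (A.card : ℝ) ↔ (¬ I ⊆ J → Disjoint A J) := by
  have hc : (A.card : ℝ) ≠ 0 := Nat.cast_ne_zero.2 hA.card_ne_zero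
  split_ifs with h
  · simp [Finset.inter_eq_left.2 (hAI.trans h), h, hc]
  · simp [h, hc, eq_comm (a := (0 : ℝ)), Finset.disjoint_iff_inter_eq_empty]

/-- The diagonal `d` is in the dissection of `v` iff on every interval that is not contained in
`arc d` the minimum of `v` is attained outside `arc d` only. One implication uses the intervals from
a coordinate adjacent to `arc d` to one inside. -/
lemma disjoint_argminOn_iff {v : Fin m → ℝ} {d : Fin (m + 2) × Fin (m + 2)}
    (hd : IsDiagonal (m + 2) d) :
    (∀ p ∈ intervals m, ¬ Finset.Icc p.1 p.2 ⊆ arc d →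
      Disjoint (argminOn v (Finset.Icc p.1 p.2)) (arc d)) ↔ d ∈ nest v := by
  constructor
  · intro h
    refine mem_nest.2 ⟨hd, fun k hk l hl => ?_⟩
    have hld := notMem_arc_of_mem_arcBoundary hd hl
    have hkey : ∀ p ∈ intervals m, l ∈ Finset.Icc p.1 p.2 → k ∈ Finset.Icc p.1 p.2 →
        (∀ i ∈ Finset.Icc p.1 p.2, i = l ∨ i ∈ arc d) → v l < v k := by
      intro p hp hlp hkp hsub
      have hdis := h p hp fun hs => hld (hs hlp)
      have hmin : ∀ i ∈ argminOn v (Finset.Icc p.1 p.2), i = l := fun i hi =>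
        (hsub i (mem_argminOn.1 hi).1).resolve_right (Finset.disjoint_left.1 hdis hi)
      obtain ⟨i, hi⟩ := argminOn_nonempty v ⟨l, hlp⟩
      obtain rfl := hmin i hi
      have hkn : k ∉ argminOn v (Finset.Icc p.1 p.2) := fun hk' =>
        Finset.disjoint_left.1 hdis hk' hk
      by_contra hle
      exact hkn (mem_argminOn.2 ⟨hkp, fun j hj =>
        (not_lt.1 hle).trans ((mem_argminOn.1 hi).2 j hj)⟩)
    have hk' := mem_arc.1 hk
    rcases mem_arcBoundary.1 hl with hl' | hl'
    · refine hkey (l, k) (mem_intervals.2 ?_) ?_ ?_ fun i hi => ?_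
      · rw [Fin.le_def]; dsimp only; lia
      · rw [Finset.mem_Icc, Fin.le_def, Fin.le_def]; dsimp only; lia
      · rw [Finset.mem_Icc, Fin.le_def, Fin.le_def]; dsimp only; lia
      · rw [Finset.mem_Icc, Fin.le_def, Fin.le_def] at hi
        dsimp only at hi
        rw [Fin.ext_iff, mem_arc]
        lia
    · refine hkey (k, l) (mem_intervals.2 ?_) ?_ ?_ fun i hi => ?_
      · rw [Fin.le_def]; dsimp only; lia
      · rw [Finset.mem_Icc, Fin.le_def, Fin.le_def]; dsimp only; lia
      · rw [Finset.mem_Icc, Fin.le_def, Fin.le_def]; dsimp only; lia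
      · rw [Finset.mem_Icc, Fin.le_def, Fin.le_def] at hi
        dsimp only at hi
        rw [Fin.ext_iff, mem_arc]
        lia
  · intro h p _ hns
    rw [Finset.disjoint_left]
    intro k hk hkd
    obtain ⟨hkI, hmin⟩ := mem_argminOn.1 hk
    obtain ⟨i, hi, hid⟩ := Finset.not_subset.1 hns
    -- an interval that meets `arc d` and leaves it contains an adjacent coordinate
    have hl : ∃ l ∈ Finset.Icc p.1 p.2, l ∈ arcBoundary d := by
      simp only [Finset.mem_Icc, Fin.le_def] at *
      rw [mem_arc] at hkd hid
      by_cases h0 : (i : ℕ) < d.1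
      · exact ⟨⟨d.1 - 1, by lia⟩, by dsimp only; lia, mem_arcBoundary.2 (by dsimp only; lia)⟩
      · exact ⟨⟨d.2 - 1, by lia⟩, by dsimp only; lia, mem_arcBoundary.2 (by dsimp only; lia)⟩
    obtain ⟨l, hlI, hl⟩ := hl
    exact absurd (hmin l hlI) (not_le.2 ((mem_nest.1 h).2 k hkd l hl))

lemma isTightPoint_lodayPoint (v : Fin m → ℝ) :
    IsTightPoint (IsDissection (m + 2)) rayVector lodayBound (nest v) (lodayPoint v) := by
  intro d hd
  rw [isDissection_singleton] at hd
  have hle : ∀ p ∈ intervals m,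
      ((if Finset.Icc p.1 p.2 ⊆ arc d then 1 else 0) - (arc d).card / (m : ℝ)) ≤
      ((argminOn v (Finset.Icc p.1 p.2) ∩ arc d).card /
        ((argminOn v (Finset.Icc p.1 p.2)).card : ℝ) - (arc d).card / (m : ℝ)) := fun p hp =>
    sub_le_sub_right (indicator_le_card_div
      (argminOn_nonempty v (Finset.nonempty_Icc.2 (mem_intervals.1 hp)))
      fun k hk => (mem_argminOn.1 hk).1) _
  rw [inner_lodayPoint, lodayBound]
  refine ⟨Finset.sum_le_sum hle, ?_⟩
  rw [eq_comm, Finset.sum_eq_sum_iff_of_le hle, ← disjoint_argminOn_iff hd]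
  refine forall₂_congr fun p hp => ?_
  rw [sub_left_inj, indicator_eq_card_div_iff
    (argminOn_nonempty v (Finset.nonempty_Icc.2 (mem_intervals.1 hp)))
    fun k hk => (mem_argminOn.1 hk).1]

lemma isSimplicialPresentation_loday :
    IsSimplicialPresentation (IsDissection (m + 2)) (rayVector (m := m)) lodayBound where
  mono h hD := isDissection_mono h hD
  exists_eq_sum v := by
    obtain ⟨S, hS, c, hc, hv⟩ := exists_eq_sum_rayVector v
    exact ⟨S, isDissection_mono hS (isDissection_nest _), c, hc, hv⟩
  exists_tight D hD := ⟨lodayPoint (depth D), by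
    have := isTightPoint_lodayPoint (depth D)
    rwa [nest_depth hD] at this⟩

lemma finrank_sumZero (m : ℕ) : finrank ℝ (sumZero m) = m - 1 := by
  cases m with
  | zero => exact finrank_zero_of_subsingleton
  | succ m =>
    set u : EuclideanSpace ℝ (Fin (m + 1)) := WithLp.toLp 2 fun _ => 1 with hu
    have h1 : sumZero (m + 1) = (Submodule.span ℝ {u})ᗮ := by
      ext x
      rw [Submodule.mem_orthogonal_singleton_iff_inner_right]
      have : ⟪u, x⟫_ℝ = ∑ k, x k := by simp [hu, PiLp.inner_apply]
      rw [this]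
      exact Iff.rfl
    have hu0 : u ≠ 0 := fun h => by
      have := congrArg (fun x : EuclideanSpace ℝ (Fin (m + 1)) => x 0) h
      simp [hu] at this
    have : Fact (finrank ℝ (EuclideanSpace ℝ (Fin (m + 1))) = m + 1) := ⟨by simp⟩
    rw [h1, Submodule.finrank_orthogonal_span_singleton (n := m) hu0, Nat.add_sub_cancel]

lemma isFlip_iff {T T' : Finset (Fin (m + 2) × Fin (m + 2))} (hT : IsTriangulation (m + 2) T)
    (hT' : IsTriangulation (m + 2) T') (hcard : T.card = T'.card) :
    IsFlip T T' ↔ T ≠ T' ∧ ∃ D, D ⊆ T ∧ D ⊆ T' ∧ D.card + 1 = T.card := by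
  constructor
  · rintro ⟨d, hd, e, he, hde, h⟩
    refine ⟨fun hTT => ?_, T.erase d, Finset.erase_subset d T, ?_, Finset.card_erase_add_one hd⟩
    · exact hT.1.2 d hd e (hTT ▸ he) hde
    · rw [h]
      exact Finset.erase_subset e T'
  · rintro ⟨hne, D, hDT, hDT', hDc⟩
    have h1 : (T \ D).card = 1 := by rw [Finset.card_sdiff_of_subset hDT]; lia
    have h1' : (T' \ D).card = 1 := by rw [Finset.card_sdiff_of_subset hDT']; lia
    obtain ⟨d, hd⟩ := Finset.card_eq_one.1 h1
    obtain ⟨e, he⟩ := Finset.card_eq_one.1 h1'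
    have hdT : d ∈ T \ D := by simp [hd]
    have heT : e ∈ T' \ D := by simp [he]
    rw [Finset.mem_sdiff] at hdT heT
    have hTd : T.erase d = D := by
      rw [← Finset.sdiff_singleton_eq_erase, ← hd, Finset.sdiff_sdiff_eq_self hDT]
    have hTe : T'.erase e = D := by
      rw [← Finset.sdiff_singleton_eq_erase, ← he, Finset.sdiff_sdiff_eq_self hDT']
    refine ⟨d, hdT.1, e, heT.1, ?_, hTd.trans hTe.symm⟩
    -- otherwise `d` could be added to `T'`
    by_contra hcr
    have hins : IsDissection (m + 2) (insert d T') := by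
      refine isDissection_insert hT'.1 (hT.1.1 d hdT.1) fun f hf => ?_
      by_cases hfe : f = e
      · exact hfe ▸ hcr
      · refine hT.1.2 d hdT.1 f (hDT ?_)
        rw [← hTe]
        exact Finset.mem_erase.2 ⟨hfe, hf⟩
    have hdT' : d ∈ T' := hT'.2 hins (Finset.subset_insert d T') (Finset.mem_insert_self d T')
    have hsub : T ⊆ T' := by
      rw [← Finset.insert_erase hdT.1, hTd]
      exact Finset.insert_subset hdT' hDT'
    exact hne (Finset.eq_of_subset_of_card_le hsub hcard.ge)

lemma isAssociahedron_loday :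
    IsAssociahedron (m + 2) (polyhedron (IsDissection (m + 2)) (rayVector (m := m)) lodayBound) := by
  have H := isSimplicialPresentation_loday (m := m)
  refine ⟨H.isPolytope, ?_, H.faceOrderIso, fun D => ?_, fun T T' hT hT' => ?_⟩
  · rw [H.dim_polyhedron, finrank_sumZero]
    lia
  · rw [H.faceOrderIso_apply]
    exact H.maximal_iff D.2
  · simp only [H.faceOrderIso_apply]
    have h1 := H.card_eq_finrank hT
    have h2 := H.card_eq_finrank hT'
    rw [H.exists_edge_iff T.2 T'.2, isFlip_iff hT hT' (h1.trans h2.symm), h1, Ne, Ne,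
      Subtype.ext_iff]

end Loday

/-! ### Stars and Weyl chambers -/

section Region

variable {m : ℕ}

/-- The diagonal whose interval is `{i, …, j}`. -/
def diagonalOf (i j : Fin m) : Fin (m + 2) × Fin (m + 2) :=
  (⟨i, by lia⟩, ⟨j + 2, by lia⟩)

lemma isDiagonal_diagonalOf {i j : Fin m} :
    IsDiagonal (m + 2) (diagonalOf i j) ↔ IsProperInterval i j := by
  rw [isDiagonal_iff, IsProperInterval, Fin.le_def]
  simp only [diagonalOf]
  lia

lemma exists_eq_diagonalOf {d : Fin (m + 2) × Fin (m + 2)} (hd : IsDiagonal (m + 2) d) :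
    ∃ i j : Fin m, d = diagonalOf i j := by
  have := isDiagonal_iff.1 hd
  refine ⟨⟨d.1, by lia⟩, ⟨d.2 - 2, by lia⟩, Prod.ext (Fin.ext rfl) (Fin.ext ?_)⟩
  simp only [diagonalOf]
  lia

lemma arc_diagonalOf (i j : Fin m) : arc (diagonalOf i j) = Finset.Icc i j := by
  ext k
  rw [mem_arc, Finset.mem_Icc, Fin.le_def, Fin.le_def]
  simp only [diagonalOf]
  lia

lemma coneOf_diagonalOf (i j : Fin m) : coneOf rayVector {diagonalOf i j} = intervalRay i j := by
  rw [coneOf_singleton, rayVector, arc_diagonalOf]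
  rfl

lemma mem_region_iff {i j : Fin m} {x : sumZero m} :
    x ∈ region i j ↔
      ∀ k ∈ arc (diagonalOf i j), ∀ l ∈ arcBoundary (diagonalOf i j), x.1 l ≤ x.1 k := by
  have hb : ∀ l : Fin m, l ∈ arcBoundary (diagonalOf i j) ↔
      ((l : ℕ) + 1 = i ∨ (l : ℕ) = j + 1) := fun l => by
    rw [mem_arcBoundary]
    simp only [diagonalOf]
    lia
  simp only [arc_diagonalOf, Finset.mem_Icc, hb, and_imp]
  exact Iff.rfl

lemma convex_region (i j : Fin m) : Convex ℝ (region i j) := by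
  intro x hx y hy s t hs ht _ k hik hkj l hl
  have h1 := mul_le_mul_of_nonneg_left (hx k hik hkj l hl) hs
  have h2 := mul_le_mul_of_nonneg_left (hy k hik hkj l hl) ht
  change s * x.1 l + t * y.1 l ≤ s * x.1 k + t * y.1 k
  exact add_le_add h1 h2

/-- A vector lies in a cone of the star of the ray of `d` iff the intervals of its dissection do
not cross `d`, which the inequalities of the region express. -/
lemma setOf_mem_coneOf_eq_region {i j : Fin m} (hij : IsProperInterval i j) :
    {v | ∃ D, IsDissection (m + 2) D ∧ diagonalOf i j ∈ D ∧ v ∈ coneOf rayVector D} =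
      region i j := by
  have hd := isDiagonal_diagonalOf.2 hij
  ext v
  rw [mem_region_iff]
  constructor
  · rintro ⟨D, hD, hdD, c, hc, rfl⟩ k hk l hl
    rw [sum_smul_rayVector_apply, sum_smul_rayVector_apply]
    refine sub_le_sub_right (Finset.sum_le_sum fun e he =>
      mul_le_mul_of_nonneg_left ?_ (hc e he)) _
    by_cases hle : l ∈ arc e
    · rw [if_pos hle, if_pos (mem_arc_of_not_cross (hD.2 _ hdD e he) hl hle hk)]
    · rw [if_neg hle]
      split_ifs <;> norm_num
  · intro hv
    obtain ⟨S, hS, c, hc, hvS⟩ := exists_eq_sum_rayVector v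
    refine ⟨insert (diagonalOf i j) S, ?_, Finset.mem_insert_self _ _,
      coneOf_mono (Finset.subset_insert _ S) ⟨c, fun e he => (hc e he).le, hvS⟩⟩
    refine isDissection_insert (isDissection_mono hS (isDissection_nest _)) hd fun e he hcr => ?_
    obtain ⟨⟨k, hk, hk'⟩, l, hl, hl'⟩ := hcr.exists_mem
    exact absurd (hv k hk l hl') (not_le.2 ((mem_nest.1 (hS he)).2 l hl k hk'))

/-- A vector of the region lies in a chamber inside the region: sort its coordinates, and among
equal coordinates put those in `{i, …, j}` first. -/
lemma region_eq_iUnion_chamber (i j : Fin m) :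
    region i j = ⋃ π : Equiv.Perm (Fin m), ⋃ _ : chamber π ⊆ region i j, chamber π := by
  refine Set.Subset.antisymm (fun x hx => ?_) (Set.iUnion₂_subset fun π hπ => hπ)
  set f : Fin m → ℝ ×ₗ ℕ :=
    fun k => toLex (-x.1 k, if i ≤ k ∧ k ≤ j then 0 else 1) with hf
  set π := Tuple.sort f
  have hmono : Monotone (f ∘ π) := Tuple.monotone_sort f
  refine Set.mem_iUnion₂.2 ⟨π, ?_, ?_⟩
  · intro y hy k hik hkj l hl
    have hlt : f k < f l := by
      have hlk := hx k hik hkj l hl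
      have hlout : ¬ (i ≤ l ∧ l ≤ j) := by
        rw [Fin.le_def, Fin.le_def] at *
        lia
      rw [Prod.Lex.lt_iff]
      simp only [hf, ofLex_toLex, hik, hkj, hlout, and_self, if_true, if_false, zero_lt_one,
        and_true, neg_lt_neg_iff, neg_inj]
      exact hlk.lt_or_eq.imp id Eq.symm
    have hle : π.symm k ≤ π.symm l := by
      by_contra hcon
      have := hmono (not_le.1 hcon).le
      simp only [Function.comp_apply, Equiv.apply_symm_apply] at this
      exact absurd this (not_le.2 hlt)
    have := hy _ _ hle
    simpa using this
  · intro a b hab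
    have := hmono hab
    rw [Function.comp_apply, Function.comp_apply, Prod.Lex.le_iff] at this
    simp only [hf, ofLex_toLex, neg_lt_neg_iff, neg_inj] at this
    rcases this with h | h
    exacts [h.le, h.1.symm.le]

end Region

lemma exists_isAssociahedron_isLocallyConvex (m : ℕ) :
    ∃ P : Set (sumZero m), IsAssociahedron (m + 2) P ∧ IsSimple P ∧
      IsLocallyConvex (normalFan P) ∧
      (∀ ρ : Set (sumZero m), IsRay (normalFan P) ρ ↔
        ∃ i j : Fin m, IsProperInterval i j ∧ ρ = intervalRay i j) ∧
      ∀ i j : Fin m, IsProperInterval i j →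
        support (star (normalFan P) (intervalRay i j)) =
          ⋃ π : Equiv.Perm (Fin m), ⋃ _ : chamber π ⊆ region i j, chamber π := by
  have H := isSimplicialPresentation_loday (m := m)
  have hray : ∀ ρ : Set (sumZero m),
      IsRay (normalFan (polyhedron (IsDissection (m + 2)) rayVector lodayBound)) ρ ↔
        ∃ i j : Fin m, IsProperInterval i j ∧ ρ = intervalRay i j := fun ρ => by
    rw [H.isRay_iff]
    constructor
    · rintro ⟨d, hd, rfl⟩
      rw [isDissection_singleton] at hd
      obtain ⟨i, j, rfl⟩ := exists_eq_diagonalOf hd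
      exact ⟨i, j, isDiagonal_diagonalOf.1 hd, coneOf_diagonalOf i j⟩
    · rintro ⟨i, j, hij, rfl⟩
      exact ⟨diagonalOf i j, isDissection_singleton.2 (isDiagonal_diagonalOf.2 hij),
        (coneOf_diagonalOf i j).symm⟩
  have hstar : ∀ i j : Fin m, IsProperInterval i j →
      support (star
        (normalFan (polyhedron (IsDissection (m + 2)) rayVector lodayBound)) (intervalRay i j)) =
        region i j := fun i j hij => by
    rw [← coneOf_diagonalOf,
      H.support_star (isDissection_singleton.2 (isDiagonal_diagonalOf.2 hij)),
      setOf_mem_coneOf_eq_region hij]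
  refine ⟨_, isAssociahedron_loday, H.isSimple, fun ρ hρ => ?_, hray, fun i j hij => ?_⟩
  · obtain ⟨i, j, hij, rfl⟩ := (hray ρ).1 hρ
    rw [hstar i j hij]
    exact convex_region i j
  · rw [hstar i j hij, ← region_eq_iUnion_chamber]

end Associahedra

theorem mainTheorem11 (n : ℕ) (hn : 3 ≤ n) :
    ∃ P : Set (Associahedra.sumZero (n - 2)),
      Associahedra.IsAssociahedron n P ∧
      Associahedra.IsSimple P ∧
      Associahedra.IsLocallyConvex (Associahedra.normalFan P) ∧
      (∀ ρ : Set (Associahedra.sumZero (n - 2)),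
        Associahedra.IsRay (Associahedra.normalFan P) ρ ↔
          ∃ i j : Fin (n - 2),
            Associahedra.IsProperInterval i j ∧ ρ = Associahedra.intervalRay i j) ∧
      ∀ i j : Fin (n - 2), Associahedra.IsProperInterval i j →
        Associahedra.support
            (Associahedra.star (Associahedra.normalFan P) (Associahedra.intervalRay i j)) =
          ⋃ π : Equiv.Perm (Fin (n - 2)),
            ⋃ _ : Associahedra.chamber π ⊆ Associahedra.region i j, Associahedra.chamber π := by
  obtain ⟨m, rfl⟩ : ∃ m, n = m + 2 := ⟨n - 2, by lia⟩
  exact Associahedra.exists_isAssociahedron_isLocallyConvex m
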